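/- Let $T \ge 2$ and consider the $T$-node Gaussian multiple relay channel with unit gains: node $1$ is the source, node $T$ the destination, and $\mathcal R=\{2,\dots,T-1\}$ is the set of relays. Nodes $1,\dots,T-1$ send real inputs $X_1,\dots,X_{T-1}$ with an arbitrary joint distribution $p(x_1,\dots,x_{T-1})$ subject to the power constraints $E[X_i^2]\le P_i$, where $P_i \ge 0$. For $j=2,\dots,T$, node $j$ receives $$Y_j=\sum_{i\in(\{1\}\cup\mathcal R)\setminus\{j\}}X_i+Z_j,$$ where $Z_2,\dots,Z_T$ are mutually independent, independent of the inputs, and $Z_j\sim\mathcal N(0,N_j)$ with $N_j>0$. Then, with natural logarithms, the maximum $$\max_{p(x_1,\dots,x_{T-1})} I(X_1;Y_{\mathcal R},Y_T\mid X_{\mathcal R})$$ over all such input distributions exists and equals $\tfrac12\log\bigl(1+P_1\sum_{j=2}^{T}\tfrac1{N_j}\bigr)$. A sufficient condition for an admissible input distribution to achieve it is that the inputs are Gaussian (the relay inputs need not be jointly Gaussian), $X_1\sim\mathcal N(0,P_1)$, and $X_1$ is independent of $X_{\mathcal R}=(X_2,\dots,X_{T-1})$. In particular, it is achieved by all admissible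 mutually independent Gaussian inputs $X_1,\dots,X_{T-1}$ with $X_1\sim\mathcal N(0,P_1)$, for instance by mutually independent $X_i\sim\mathcal N(0,P_i)$. -/

import Mathlib

open MeasureTheory ProbabilityTheory InformationTheory
open scoped NNReal ENNReal

namespace RelayChannel

/-- Conditional mutual information `I(A; B | C)` (in nats) of random variables `A`, `B`, `C` under
the probability measure `Q`: the Kullback-Leibler divergence of the joint law of `(C, A, B)` from
the law `P_C ⊗ (P_{A|C} × P_{B|C})` under which `A` and `B` are independent given `C`. -/
noncomputable def condMutualInfo {Ω α β γ : Type*} [MeasurableSpace Ω]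
    [MeasurableSpace α] [StandardBorelSpace α] [Nonempty α]
    [MeasurableSpace β] [StandardBorelSpace β] [Nonempty β]
    [MeasurableSpace γ]
    (A : Ω → α) (B : Ω → β) (C : Ω → γ) (Q : Measure Ω) [IsFiniteMeasure Q] : ℝ≥0∞ :=
  klDiv (Q.map (fun ω => (C ω, A ω, B ω)))
    ((Q.map C).compProd ((condDistrib A C Q).prod (condDistrib B C Q)))

/-! The channel has `T = m + 2` nodes, of which `m` are relays. The nodes, usually labelled
`1, …, T`, are listed by `Fin (m + 2)`: source `0`, relays `1, …, m`, destination `m + 1`.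
Senders (all nodes but the destination) are indexed by `i : Fin (m + 1)`, standing for the node
`i.castSucc`; receivers (all nodes but the source) are indexed by `j : Fin (m + 1)`, standing for
the node `j.succ`. -/

/-- The signals received when the senders transmit `x` and the receiver noise is `z`, with unit
gains: each receiver hears the sum of the inputs of all senders other than itself, plus noise. -/
def received {m : ℕ} (x z : Fin (m + 1) → ℝ) (j : Fin (m + 1)) : ℝ :=
  (∑ i with i.castSucc ≠ j.succ, x i) + z j

/-- The input of the source. -/
def sourceInput {m : ℕ} (x : Fin (m + 1) → ℝ) : ℝ := x 0

/-- The inputs of the relays. -/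
def relayInputs {m : ℕ} (x : Fin (m + 1) → ℝ) : Fin m → ℝ := fun k => x k.succ

/-- The law of the receiver noise: independent centred Gaussians of variances `N j`. -/
noncomputable def noiseLaw {m : ℕ} (N : Fin (m + 1) → ℝ≥0) : Measure (Fin (m + 1) → ℝ) :=
  Measure.pi fun j => gaussianReal 0 (N j)

instance {m : ℕ} (N : Fin (m + 1) → ℝ≥0) : IsProbabilityMeasure (noiseLaw N) := by
  unfold noiseLaw; infer_instance

/-- `I(X₁; Y_R, Y_T | X_R)` when the inputs have joint law `p` and the noise is independent
of the inputs. -/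
noncomputable def cutInfo {m : ℕ} (N : Fin (m + 1) → ℝ≥0)
    (p : ProbabilityMeasure (Fin (m + 1) → ℝ)) : ℝ≥0∞ :=
  condMutualInfo (fun ω => sourceInput ω.1) (fun ω => received ω.1 ω.2)
    (fun ω => relayInputs ω.1) ((p : Measure (Fin (m + 1) → ℝ)).prod (noiseLaw N))

/-- The input distributions satisfying the power constraints `E[X_i ^ 2] ≤ P_i`. -/
def admissible {m : ℕ} (P : Fin (m + 1) → ℝ≥0) :
    Set (ProbabilityMeasure (Fin (m + 1) → ℝ)) :=
  {p | ∀ i, Integrable (fun x => x i ^ 2) (p : Measure (Fin (m + 1) → ℝ)) ∧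
    ∫ x, x i ^ 2 ∂(p : Measure (Fin (m + 1) → ℝ)) ≤ P i}

/-- Fully independent centred Gaussian inputs of variances `P i`. -/
noncomputable def indepGaussianInputs {m : ℕ} (P : Fin (m + 1) → ℝ≥0) :
    ProbabilityMeasure (Fin (m + 1) → ℝ) :=
  ⟨Measure.pi fun i => gaussianReal 0 (P i), inferInstance⟩

end RelayChannel

/-! Every receiver hears the source with unit gain, so once the relay inputs are known and their
contribution is subtracted, the receivers observe the common signal $X_1$ in independent noises. Let
$S=\sum_j 1/N_j$ and let $P$ be the power allowed to the source. The upper bound avoids differential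
entropies. For any reference kernel $\eta$ from $X_{\mathcal R}$ to the outputs $Y$, the golden
formula `klDiv_add_condMutualInfo` gives $D(P_{X_{\mathcal R}Y}\|P_{X_{\mathcal
R}}\otimes\eta)+I(X_1;Y\mid X_{\mathcal R})=D(P_{X_{\mathcal R}X_1Y}\|P_{X_{\mathcal
R}}\otimes(P_{X_1\mid X_{\mathcal R}}\times\eta))$. Take for $\eta$ the output law produced by an
$\mathcal N(0,P)$ source independent of the relays. The log-density on the right is then quadratic,
and `klDiv_signal_add_noise` evaluates that side as
$\frac12\log(1+PS)+(E[X_1^2]-P)\frac{S}{2(1+PS)}$, whatever the input law with finite source power.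
The bound follows because divergence is nonnegative and $E[X_1^2]\le P$. It is attained when
$X_1\sim\mathcal N(0,P)$ is independent of $X_{\mathcal R}$, for then the outputs follow the
reference law and both losses vanish. -/

namespace RelayChannel

/-! ### Densities of shifted and Gaussian-mixed noise -/

/-- On a box, the indicator times the product density factors over coordinates, which are
independent under the product measure. -/
theorem pi_withDensity {ι : Type*} [Fintype ι] {Ω : ι → Type*} [∀ i, MeasurableSpace (Ω i)]
    (μ : ∀ i, Measure (Ω i)) [∀ i, IsProbabilityMeasure (μ i)] {f : ∀ i, Ω i → ℝ≥0∞}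
    (hf : ∀ i, Measurable (f i)) [∀ i, SigmaFinite ((μ i).withDensity (f i))] :
    Measure.pi (fun i => (μ i).withDensity (f i)) =
      (Measure.pi μ).withDensity (fun x => ∏ i, f i (x i)) := by
  refine Measure.pi_eq fun s hs => ?_
  rw [withDensity_apply _ (MeasurableSet.univ_pi hs),
    ← lintegral_indicator (MeasurableSet.univ_pi hs)]
  have h : (Set.univ.pi s).indicator (fun x => ∏ i, f i (x i)) =
      fun x => ∏ i, (s i).indicator (f i) (x i) := by
    ext x
    by_cases hx : x ∈ Set.univ.pi s
    · rw [Set.indicator_of_mem hx]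
      exact Finset.prod_congr rfl fun i _ => (Set.indicator_of_mem (hx i trivial) _).symm
    · rw [Set.indicator_of_notMem hx]
      simp only [Set.mem_pi, Set.mem_univ, true_imp_iff, not_forall] at hx
      obtain ⟨i, hi⟩ := hx
      exact (Finset.prod_eq_zero (Finset.mem_univ i) (Set.indicator_of_notMem hi _)).symm
  have hm : ∀ i, Measurable ((s i).indicator (f i)) := fun i => (hf i).indicator (hs i)
  rw [h, lintegral_prod_eq_prod_lintegral_of_indepFun Finset.univ
    (fun i (x : ∀ i, Ω i) => (s i).indicator (f i) (x i))
    (iIndepFun_pi fun i => (hm i).aemeasurable) fun i => (hm i).comp (measurable_pi_apply i)]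
  refine Finset.prod_congr rfl fun i _ => ?_
  rw [withDensity_apply _ (hs i), ← lintegral_indicator (hs i),
    ← (measurePreserving_eval μ i).lintegral_comp (hm i)]

theorem gaussianReal_eq_withDensity_gaussianReal_zero (a : ℝ) {v : ℝ≥0} (hv : v ≠ 0) :
    gaussianReal a v = (gaussianReal 0 v).withDensity
      (fun z => ENNReal.ofReal (Real.exp (a * (z / v) - a ^ 2 / 2 * (1 / v)))) := by
  have hv' : (v : ℝ) ≠ 0 := by exact_mod_cast hv
  rw [gaussianReal_of_var_ne_zero a hv, gaussianReal_of_var_ne_zero 0 hv,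
    ← withDensity_mul _ (measurable_gaussianPDF 0 v) (by fun_prop)]
  congr 1
  ext z
  simp only [Pi.mul_apply, gaussianPDF]
  rw [← ENNReal.ofReal_mul (gaussianPDFReal_nonneg _ _ _), gaussianPDFReal, gaussianPDFReal,
    mul_assoc (√(2 * Real.pi * v))⁻¹, ← Real.exp_add]
  congr 3
  field_simp
  ring

/-- The total precision `∑ 1 / N j` of the noise. -/
noncomputable def totalPrecision {m : ℕ} (N : Fin (m + 1) → ℝ≥0) : ℝ := ∑ j, 1 / (N j : ℝ)

/-- The sufficient statistic `∑ z j / N j` for a common signal observed by all receivers. -/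
noncomputable def precisionSum {m : ℕ} (N : Fin (m + 1) → ℝ≥0) (z : Fin (m + 1) → ℝ) : ℝ :=
  ∑ j, z j / (N j : ℝ)

/-- The law of `G + Z j`, with the noise `Z` and an independent common signal `G` that is centred
Gaussian of variance `P`. -/
noncomputable def gaussianOutputLaw {m : ℕ} (P : ℝ≥0) (N : Fin (m + 1) → ℝ≥0) :
    Measure (Fin (m + 1) → ℝ) :=
  ((gaussianReal 0 P).prod (noiseLaw N)).map fun w j => w.1 + w.2 j

/-- The logarithm of the density of `gaussianOutputLaw P N` with respect to the noise law. -/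
noncomputable def logOutputDensity {m : ℕ} (P : ℝ≥0) (N : Fin (m + 1) → ℝ≥0)
    (z : Fin (m + 1) → ℝ) : ℝ :=
  P * precisionSum N z ^ 2 / (2 * (1 + P * totalPrecision N)) -
    1 / 2 * Real.log (1 + P * totalPrecision N)

section

variable {m : ℕ} {P : ℝ≥0} {N : Fin (m + 1) → ℝ≥0}

theorem totalPrecision_nonneg (N : Fin (m + 1) → ℝ≥0) : 0 ≤ totalPrecision N :=
  Finset.sum_nonneg fun j _ => by positivity

@[fun_prop]
theorem measurable_precisionSum (N : Fin (m + 1) → ℝ≥0) : Measurable (precisionSum N) := by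
  unfold precisionSum; fun_prop

@[fun_prop]
theorem measurable_logOutputDensity (P : ℝ≥0) (N : Fin (m + 1) → ℝ≥0) :
    Measurable (logOutputDensity P N) := by
  unfold logOutputDensity; fun_prop

instance (P : ℝ≥0) (N : Fin (m + 1) → ℝ≥0) : IsProbabilityMeasure (gaussianOutputLaw P N) :=
  Measure.isProbabilityMeasure_map (by fun_prop)

/-- The one-dimensional likelihood ratios multiply, so their exponents add; $z$ enters only through
the sufficient statistic `precisionSum N z`. -/
theorem noiseLaw_map_add (hN : ∀ j, 0 < N j) (a : ℝ) :
    (noiseLaw N).map (fun z j => a + z j) = (noiseLaw N).withDensity fun z =>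
      ENNReal.ofReal (Real.exp (a * precisionSum N z - a ^ 2 / 2 * totalPrecision N)) := by
  have h1 : (noiseLaw N).map (fun z j => a + z j) = Measure.pi fun j => gaussianReal a (N j) := by
    rw [noiseLaw, Measure.pi_map_pi (f := fun _ z => a + z) (fun j => by fun_prop)]
    simp [gaussianReal_map_const_add]
  have h2 : ∀ j, gaussianReal a (N j) = (gaussianReal 0 (N j)).withDensity
      (fun z => ENNReal.ofReal (Real.exp (a * (z / N j) - a ^ 2 / 2 * (1 / N j)))) :=
    fun j => gaussianReal_eq_withDensity_gaussianReal_zero a (hN j).ne'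
  have : ∀ j, SigmaFinite ((gaussianReal 0 (N j)).withDensity
      (fun z => ENNReal.ofReal (Real.exp (a * (z / N j) - a ^ 2 / 2 * (1 / N j))))) :=
    fun j => by rw [← h2]; infer_instance
  rw [h1, funext h2, pi_withDensity _ fun j => by fun_prop, noiseLaw]
  congr 1
  ext z
  rw [← ENNReal.ofReal_prod_of_nonneg fun _ _ => (Real.exp_pos _).le, ← Real.exp_sum,
    Finset.sum_sub_distrib, ← Finset.mul_sum, ← Finset.mul_sum]
  rfl

theorem lintegral_noiseLaw_add (hN : ∀ j, 0 < N j) (a : ℝ) {F : (Fin (m + 1) → ℝ) → ℝ≥0∞}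
    (hF : Measurable F) :
    ∫⁻ z, F (fun j => a + z j) ∂noiseLaw N = ∫⁻ z, ENNReal.ofReal
      (Real.exp (a * precisionSum N z - a ^ 2 / 2 * totalPrecision N)) * F z ∂noiseLaw N := by
  rw [← lintegral_map (f := F) (g := fun (z : Fin (m + 1) → ℝ) j => a + z j) hF (by fun_prop),
    noiseLaw_map_add hN a, lintegral_withDensity_eq_lintegral_mul _ (by fun_prop) hF]
  rfl

/-- Completing the square, as in Bayes' rule: prior times likelihood is the evidence, constant in
$a$, times the posterior density, which integrates to one. -/
theorem lintegral_exp_gaussianReal (P : ℝ≥0) {S : ℝ} (hS : 0 ≤ S) (t : ℝ) :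
    ∫⁻ a, ENNReal.ofReal (Real.exp (a * t - a ^ 2 / 2 * S)) ∂gaussianReal 0 P =
      ENNReal.ofReal
        (Real.exp (P * t ^ 2 / (2 * (1 + P * S)) - 1 / 2 * Real.log (1 + P * S))) := by
  rcases eq_or_ne P 0 with rfl | hP
  · simp
  have hP0 : (0 : ℝ) < P := by positivity
  have hD : 0 < 1 + P * S := by positivity
  -- The posterior variance; the posterior mean is $Vt$.
  set V : ℝ≥0 := P / (1 + P * ⟨S, hS⟩) with hV
  have hVr : (V : ℝ) = P / (1 + P * S) := by simp [hV]; rfl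
  have hV0 : V ≠ 0 := by
    have : (0 : ℝ) < V := by rw [hVr]; positivity
    exact_mod_cast this.ne'
  rw [gaussianReal_of_var_ne_zero 0 hP,
    lintegral_withDensity_eq_lintegral_mul _ (measurable_gaussianPDF 0 P) (by fun_prop)]
  have key : ∀ a : ℝ, (gaussianPDF 0 P * fun a =>
      ENNReal.ofReal (Real.exp (a * t - a ^ 2 / 2 * S))) a =
      ENNReal.ofReal
        (Real.exp (P * t ^ 2 / (2 * (1 + P * S)) - 1 / 2 * Real.log (1 + P * S))) *
        gaussianPDF (V * t) V a := by
    intro a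
    simp only [Pi.mul_apply, gaussianPDF]
    rw [← ENNReal.ofReal_mul (gaussianPDFReal_nonneg _ _ _),
      ← ENNReal.ofReal_mul (Real.exp_pos _).le, gaussianPDFReal, gaussianPDFReal, hVr]
    congr 1
    have e1 : Real.exp (-(1 / 2 * Real.log (1 + P * S))) = (√(1 + P * S))⁻¹ := by
      rw [Real.exp_neg, one_div_mul_eq_div, Real.exp_half, Real.exp_log hD]
    have e2 : √(2 * Real.pi * (P / (1 + P * S))) = √(2 * Real.pi * P) / √(1 + P * S) := by
      rw [← Real.sqrt_div' _ hD.le]; congr 1; ring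
    rw [sub_eq_add_neg (_ / _), Real.exp_add, e1, e2, mul_assoc (√(2 * Real.pi * P))⁻¹,
      ← Real.exp_add]
    have hs : √(1 + P * S) ≠ 0 := by positivity
    rw [show Real.exp (P * t ^ 2 / (2 * (1 + P * S))) * (√(1 + P * S))⁻¹ *
      ((√(2 * Real.pi * P) / √(1 + P * S))⁻¹ *
        Real.exp (-(a - P / (1 + P * S) * t) ^ 2 / (2 * (P / (1 + P * S))))) =
      (√(2 * Real.pi * P))⁻¹ * (Real.exp (P * t ^ 2 / (2 * (1 + P * S))) *
        Real.exp (-(a - P / (1 + P * S) * t) ^ 2 / (2 * (P / (1 + P * S))))) by field_simp,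
      ← Real.exp_add]
    congr 2
    field_simp
    ring
  simp_rw [key]
  rw [lintegral_const_mul _ (measurable_gaussianPDF _ _), lintegral_gaussianPDF_eq_one _ hV0,
    mul_one]

/-- By Tonelli, the density is the Gaussian average over $a$ of the density of the noise shifted by
$a$. -/
theorem gaussianOutputLaw_eq_withDensity (hN : ∀ j, 0 < N j) :
    gaussianOutputLaw P N = (noiseLaw N).withDensity fun z =>
      ENNReal.ofReal (Real.exp (logOutputDensity P N z)) := by
  refine Measure.ext_of_lintegral _ fun F hF => ?_
  rw [gaussianOutputLaw, lintegral_map hF (by fun_prop),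
    lintegral_prod _ (by fun_prop : Measurable _).aemeasurable,
    lintegral_withDensity_eq_lintegral_mul _ (by fun_prop) hF]
  simp_rw [lintegral_noiseLaw_add hN _ hF]
  rw [lintegral_lintegral_swap (by fun_prop)]
  refine lintegral_congr fun z => ?_
  rw [lintegral_mul_const _ (by fun_prop),
    lintegral_exp_gaussianReal P (totalPrecision_nonneg N)]
  rfl

/-- The log-likelihood ratio of observing the signal `a` in the noise against
`gaussianOutputLaw P N`. -/
noncomputable def logLikelihood (P : ℝ≥0) (N : Fin (m + 1) → ℝ≥0) (a : ℝ)
    (z : Fin (m + 1) → ℝ) : ℝ :=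
  a * precisionSum N z - a ^ 2 / 2 * totalPrecision N - logOutputDensity P N z

theorem prod_noiseLaw_map_add {X : Type*} [MeasurableSpace X] (p : Measure X)
    [IsProbabilityMeasure p] {u : X → ℝ} (hu : Measurable u) (hN : ∀ j, 0 < N j) :
    (p.prod (noiseLaw N)).map (fun w => (w.1, fun j => u w.1 + w.2 j)) =
      (p.prod (gaussianOutputLaw P N)).withDensity fun w =>
        ENNReal.ofReal (Real.exp (logLikelihood P N (u w.1) w.2)) := by
  have hL : Measurable fun w : X × (Fin (m + 1) → ℝ) => logLikelihood P N (u w.1) w.2 := by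
    unfold logLikelihood; fun_prop
  refine Measure.ext_of_lintegral _ fun F hF => ?_
  rw [lintegral_map hF (by fun_prop), lintegral_prod _ (by fun_prop : Measurable _).aemeasurable,
    lintegral_withDensity_eq_lintegral_mul _ (by fun_prop) hF,
    lintegral_prod _ (by fun_prop : Measurable _).aemeasurable]
  refine lintegral_congr fun x => ?_
  rw [lintegral_noiseLaw_add hN (u x) (F := fun z => F (x, z)) (by fun_prop),
    gaussianOutputLaw_eq_withDensity hN,
    lintegral_withDensity_eq_lintegral_mul _ (by fun_prop) (by fun_prop)]
  refine lintegral_congr fun z => ?_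
  simp only [Pi.mul_apply]
  rw [← mul_assoc, ← ENNReal.ofReal_mul (Real.exp_pos _).le, ← Real.exp_add, logLikelihood]
  congr 4
  ring

end

/-! ### Divergence of signal plus noise from the Gaussian output law -/

/-- Data processing applied to $f$ and then to its left inverse. -/
theorem klDiv_map_of_leftInverse {X Y : Type*} [MeasurableSpace X] [MeasurableSpace Y]
    (μ ν : Measure X) [IsFiniteMeasure μ] [IsFiniteMeasure ν] {f : X → Y} {g : Y → X}
    (hf : Measurable f) (hg : Measurable g) (hgf : Function.LeftInverse g f) :
    klDiv (μ.map f) (ν.map f) = klDiv μ ν := by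
  refine le_antisymm (klDiv_map_le μ ν hf) ?_
  have h := klDiv_map_le (μ.map f) (ν.map f) hg
  rwa [Measure.map_map hg hf, Measure.map_map hg hf, hgf.comp_eq_id, Measure.map_id,
    Measure.map_id] at h

theorem klDiv_withDensity_exp {X : Type*} [MeasurableSpace X] (μ ν : Measure X)
    [IsProbabilityMeasure μ] [IsProbabilityMeasure ν] {l : X → ℝ} (hl : Measurable l)
    (h : μ = ν.withDensity fun x => ENNReal.ofReal (Real.exp (l x))) (hint : Integrable l μ) :
    klDiv μ ν = ENNReal.ofReal (∫ x, l x ∂μ) := by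
  have hac : μ ≪ ν := h ▸ withDensity_absolutelyContinuous _ _
  have hllr : llr μ ν =ᵐ[μ] l := by
    have : μ.rnDeriv ν =ᵐ[ν] fun x => ENNReal.ofReal (Real.exp (l x)) := by
      conv_lhs => rw [h]
      exact Measure.rnDeriv_withDensity _ (by fun_prop)
    filter_upwards [hac.ae_le this] with x hx
    rw [llr, hx, ENNReal.toReal_ofReal (Real.exp_pos _).le, Real.log_exp]
  rw [klDiv_of_ac_of_integrable hac ((integrable_congr hllr).2 hint), integral_congr_ae hllr]
  simp

section

variable {m : ℕ} {P : ℝ≥0} {N : Fin (m + 1) → ℝ≥0}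

theorem memLp_precisionSum (N : Fin (m + 1) → ℝ≥0) : MemLp (precisionSum N) 2 (noiseLaw N) := by
  refine memLp_finsetSum _ fun j _ => ?_
  have h : MemLp (fun z : ℝ => z / (N j : ℝ)) 2 (gaussianReal 0 (N j)) := by
    simpa [div_eq_inv_mul] using (memLp_id_gaussianReal (μ := 0) (v := N j) 2).const_mul (N j : ℝ)⁻¹
  exact h.comp_measurePreserving (measurePreserving_eval (fun j => gaussianReal 0 (N j)) j)

theorem integral_precisionSum (N : Fin (m + 1) → ℝ≥0) :
    ∫ z, precisionSum N z ∂noiseLaw N = 0 := by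
  have hj : ∀ j, Integrable (fun z : Fin (m + 1) → ℝ => z j / (N j : ℝ)) (noiseLaw N) := fun j =>
    (((memLp_id_gaussianReal (μ := 0) (v := N j) 1).comp_measurePreserving
      (measurePreserving_eval (fun j => gaussianReal 0 (N j)) j)).integrable le_rfl).div_const _
  unfold precisionSum
  rw [integral_finsetSum _ fun j _ => hj j]
  refine Finset.sum_eq_zero fun j _ => ?_
  rw [integral_div, noiseLaw, integral_eval]
  simp

theorem integral_precisionSum_sq (hN : ∀ j, 0 < N j) :
    ∫ z, precisionSum N z ^ 2 ∂noiseLaw N = totalPrecision N := by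
  have h : ∀ j, MemLp (fun z : ℝ => z / (N j : ℝ)) 2 (gaussianReal 0 (N j)) := fun j => by
    simpa [div_eq_inv_mul] using (memLp_id_gaussianReal (μ := 0) (v := N j) 2).const_mul (N j : ℝ)⁻¹
  have hv := variance_sum_pi h
  rw [← noiseLaw, variance_of_integral_eq_zero] at hv
  · simp only [Finset.sum_apply] at hv
    refine hv.trans (Finset.sum_congr rfl fun j _ => ?_)
    have : (N j : ℝ) ≠ 0 := by exact_mod_cast (hN j).ne'
    simp_rw [div_eq_inv_mul]
    rw [variance_const_mul, variance_fun_id_gaussianReal]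
    field_simp
  · fun_prop
  · simpa [precisionSum] using integral_precisionSum N

theorem precisionSum_add (N : Fin (m + 1) → ℝ≥0) (a : ℝ) (z : Fin (m + 1) → ℝ) :
    precisionSum N (fun j => a + z j) = a * totalPrecision N + precisionSum N z := by
  simp only [precisionSum, totalPrecision, add_div, Finset.sum_add_distrib, Finset.mul_sum,
    mul_one_div]

/-- At the output $u+z$ the log-likelihood is a quadratic polynomial in $u$ and $t=$ `precisionSum N
z`. The cross term averages to zero since $t$ is centred and independent of $u$, and $E[t^2]=S$, so
the law of $u$ matters only through its second moment. -/
theorem klDiv_signal_add_noise {X : Type*} [MeasurableSpace X] (p : Measure X)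
    [IsProbabilityMeasure p] {u : X → ℝ} (hu : Measurable u) (hu2 : Integrable (fun x => u x ^ 2) p)
    (hN : ∀ j, 0 < N j) :
    klDiv ((p.prod (noiseLaw N)).map (fun w => (w.1, fun j => u w.1 + w.2 j)))
      (p.prod (gaussianOutputLaw P N)) =
      ENNReal.ofReal (1 / 2 * Real.log (1 + P * totalPrecision N) +
        (∫ x, u x ^ 2 ∂p - P) * (totalPrecision N / (2 * (1 + P * totalPrecision N)))) := by
  have hL : Measurable fun w : X × (Fin (m + 1) → ℝ) => logLikelihood P N (u w.1) w.2 := by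
    unfold logLikelihood; fun_prop
  have hf : Measurable fun w : X × (Fin (m + 1) → ℝ) => (w.1, fun j => u w.1 + w.2 j) := by
    fun_prop
  have := Measure.isProbabilityMeasure_map (μ := p.prod (noiseLaw N)) hf.aemeasurable
  set S := totalPrecision N with hS
  have hD : 0 < 1 + P * S := by have := totalPrecision_nonneg N; positivity
  have hD0 : 1 + (P : ℝ) * S ≠ 0 := hD.ne'
  have huL : MemLp u 2 p := (memLp_two_iff_integrable_sq hu.aestronglyMeasurable).2 hu2
  have hu1 : Integrable u p := huL.integrable one_le_two
  have ht1 : Integrable (precisionSum N) (noiseLaw N) := (memLp_precisionSum N).integrable one_le_two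
  have ht2 : Integrable (fun z => precisionSum N z ^ 2) (noiseLaw N) :=
    (memLp_precisionSum N).integrable_sq
  have i1 : Integrable (fun w : X × (Fin (m + 1) → ℝ) => u w.1 ^ 2) (p.prod (noiseLaw N)) :=
    hu2.comp_fst _
  have i2 : Integrable (fun w : X × (Fin (m + 1) → ℝ) => u w.1 * precisionSum N w.2)
    (p.prod (noiseLaw N)) := hu1.mul_prod ht1
  have i3 : Integrable (fun w : X × (Fin (m + 1) → ℝ) => precisionSum N w.2 ^ 2)
    (p.prod (noiseLaw N)) := ht2.comp_snd _
  have e1 : ∫ w, u w.1 ^ 2 ∂(p.prod (noiseLaw N)) = ∫ x, u x ^ 2 ∂p := by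
    rw [integral_fun_fst (fun x => u x ^ 2)]; simp
  have e2 : ∫ w, u w.1 * precisionSum N w.2 ∂(p.prod (noiseLaw N)) = 0 := by
    rw [integral_prod_mul, integral_precisionSum, mul_zero]
  have e3 : ∫ w : X × (Fin (m + 1) → ℝ), precisionSum N w.2 ^ 2 ∂(p.prod (noiseLaw N)) = S := by
    rw [integral_fun_snd (fun z => precisionSum N z ^ 2), integral_precisionSum_sq hN]; simp [hS]
  have hpt : (fun w : X × (Fin (m + 1) → ℝ) => logLikelihood P N (u w.1) fun j => u w.1 + w.2 j) =
      fun w => S / (2 * (1 + P * S)) * u w.1 ^ 2 +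
        1 / (1 + P * S) * (u w.1 * precisionSum N w.2) +
        -P / (2 * (1 + P * S)) * precisionSum N w.2 ^ 2 + 1 / 2 * Real.log (1 + P * S) := by
    ext w
    rw [logLikelihood, logOutputDensity, precisionSum_add, ← hS]
    generalize precisionSum N w.2 = t, u w.1 = a, Real.log (1 + P * S) = L
    -- With $1+PS$ abstracted to an atom $D$, clearing denominators leaves a polynomial identity
    -- modulo $PS=D-1$.
    have hPS : (P : ℝ) * S = 1 + P * S - 1 := by ring
    generalize 1 + (P : ℝ) * S = D at *
    field_simp
    linear_combination (-S * a ^ 2 - 2 * a * t) * hPS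
  have i12 := (i1.const_mul (S / (2 * (1 + P * S)))).fun_add (i2.const_mul (1 / (1 + P * S)))
  have i123 := i12.fun_add (i3.const_mul (-P / (2 * (1 + P * S))))
  have hint := i123.fun_add (integrable_const (1 / 2 * Real.log (1 + P * S)))
  rw [klDiv_withDensity_exp _ _ hL (prod_noiseLaw_map_add p hu hN),
    integral_map hf.aemeasurable hL.aestronglyMeasurable]
  · congr 1
    simp only [hpt]
    rw [integral_add i123 (integrable_const _), integral_add i12 (i3.const_mul _),
      integral_add (i1.const_mul _) (i2.const_mul _)]
    simp only [integral_const_mul]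
    rw [e1, e2, e3]
    simp
    field_simp
    ring
  · rw [integrable_map_measure hL.aestronglyMeasurable hf.aemeasurable]
    exact (congrArg (Integrable · (p.prod (noiseLaw N))) hpt).mpr hint

end

/-! ### The golden formula -/

/-- Given the $\gamma$-coordinate the other two are independent, so the $\beta$-coordinate may be
drawn first without affecting the draw from `κ`. This order suits the chain rule. -/
theorem compProd_prod_map {α β γ : Type*} [MeasurableSpace α] [MeasurableSpace β]
    [MeasurableSpace γ] {κ : Kernel γ α} {η : Kernel γ β} [IsMarkovKernel κ] [IsMarkovKernel η]
    (μ : Measure γ) [IsFiniteMeasure μ] :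
    (μ.compProd (κ.prod η)).map (fun w => ((w.1, w.2.2), w.2.1)) =
      (μ.compProd η).compProd (κ.prodMkRight β) := by
  refine Measure.ext_of_lintegral _ fun F hF => ?_
  rw [lintegral_map hF (by fun_prop), Measure.lintegral_compProd (by fun_prop),
    Measure.lintegral_compProd hF, Measure.lintegral_compProd (hF.lintegral_kernel_prod_right')]
  refine lintegral_congr fun c => ?_
  rw [Kernel.lintegral_prod_symm _ _ _ (by fun_prop)]
  simp

/-- The golden formula: replacing the conditional law of `B` given `C` by a reference kernel
increases the divergence by the divergence of the law of `(C, B)` from its reference. -/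
theorem klDiv_add_condMutualInfo {Ω α β γ : Type*} [MeasurableSpace Ω] [MeasurableSpace α]
    [StandardBorelSpace α] [Nonempty α] [MeasurableSpace β] [StandardBorelSpace β] [Nonempty β]
    [MeasurableSpace γ] {A : Ω → α} {B : Ω → β} {C : Ω → γ} (Q : Measure Ω)
    [IsFiniteMeasure Q] (hA : Measurable A) (hB : Measurable B) (hC : Measurable C)
    (η : Kernel γ β) [IsMarkovKernel η] :
    klDiv (Q.map fun ω => (C ω, B ω)) ((Q.map C).compProd η) + condMutualInfo A B C Q =
      klDiv (Q.map fun ω => (C ω, A ω, B ω))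
        ((Q.map C).compProd ((condDistrib A C Q).prod η)) := by
  have hf : Measurable fun w : γ × α × β => ((w.1, w.2.2), w.2.1) := by fun_prop
  have hg : Measurable fun w : (γ × β) × α => (w.1.1, w.2, w.1.2) := by fun_prop
  have hmap : (Q.map fun ω => (C ω, A ω, B ω)).map (fun w => ((w.1, w.2.2), w.2.1)) =
      (Q.map fun ω => (C ω, B ω)).compProd (condDistrib A (fun ω => (C ω, B ω)) Q) := by
    rw [compProd_map_condDistrib hA.aemeasurable, Measure.map_map hf (by fun_prop)]
    rfl
  -- Once $(C,B)$ comes first, `θ` affects only the first factor of the second measure. In the chain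
  -- rule, the conditional term for $A$ is therefore the same for every `θ`; for the true
  -- conditional law of $B$ it is the conditional mutual information.
  have key : ∀ (θ : Kernel γ β) [IsMarkovKernel θ],
      klDiv (Q.map fun ω => (C ω, A ω, B ω))
        ((Q.map C).compProd ((condDistrib A C Q).prod θ)) =
      klDiv ((Q.map fun ω => (C ω, B ω)).compProd (condDistrib A (fun ω => (C ω, B ω)) Q))
        (((Q.map C).compProd θ).compProd ((condDistrib A C Q).prodMkRight β)) := by
    intro θ _
    rw [← hmap, ← compProd_prod_map, klDiv_map_of_leftInverse _ _ hf hg fun _ => rfl]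
  rw [condMutualInfo, key, key, compProd_map_condDistrib hB.aemeasurable, ← klDiv_compProd_eq_add]

/-! ### The relay channel as a common signal in noise -/

section

variable {m : ℕ} {P : ℝ≥0} {N : Fin (m + 1) → ℝ≥0}

/-- The part of the received signals caused by the relay inputs. -/
def relayOffset (c : Fin m → ℝ) (j : Fin (m + 1)) : ℝ :=
  ∑ i with i.castSucc ≠ j.succ, (Fin.cons 0 c : Fin (m + 1) → ℝ) i

@[fun_prop]
theorem measurable_relayOffset : Measurable (relayOffset (m := m)) := by
  refine measurable_pi_lambda _ fun j => Finset.measurable_fun_sum _ fun i _ => ?_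
  refine Fin.cases ?_ (fun k => ?_) i
  · simp
  · simpa using measurable_pi_apply k

@[fun_prop]
theorem measurable_sourceInput : Measurable (sourceInput (m := m)) := measurable_pi_apply 0

@[fun_prop]
theorem measurable_relayInputs : Measurable (relayInputs (m := m)) :=
  measurable_pi_lambda _ fun k => measurable_pi_apply k.succ

/-- The source is never a receiver, so the exclusion of a node's own input never removes the source
term. -/
theorem received_eq (x z : Fin (m + 1) → ℝ) :
    received x z = relayOffset (relayInputs x) + fun j => sourceInput x + z j := by
  ext j
  have hx : ∀ i, x i = (if i = 0 then sourceInput x else 0) +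
      (Fin.cons 0 (relayInputs x) : Fin (m + 1) → ℝ) i := by
    refine Fin.cases ?_ fun k => ?_
    · simp [sourceInput]
    · simp [relayInputs, Fin.succ_ne_zero]
  have h0 : (0 : Fin (m + 1)).castSucc ≠ j.succ := (Fin.succ_ne_zero j).symm
  rw [received, Finset.sum_congr rfl fun i _ => hx i, Finset.sum_add_distrib,
    Finset.sum_ite_eq' , if_pos (by simpa using h0)]
  simp only [Pi.add_apply, relayOffset]
  ring

theorem measurable_received :
    Measurable fun w : (Fin (m + 1) → ℝ) × (Fin (m + 1) → ℝ) => received w.1 w.2 := by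
  simp_rw [received_eq]
  fun_prop

/-- The reference law of the received signals given the relay inputs, under which the source is
centred Gaussian of variance `P` and independent of the relays. -/
noncomputable def referenceKernel (P : ℝ≥0) (N : Fin (m + 1) → ℝ≥0) :
    Kernel (Fin m → ℝ) (Fin (m + 1) → ℝ) :=
  (Kernel.id.prod (Kernel.const _ (gaussianOutputLaw P N))).map fun w => relayOffset w.1 + w.2

instance (P : ℝ≥0) (N : Fin (m + 1) → ℝ≥0) : IsMarkovKernel (referenceKernel P N) :=
  Kernel.IsMarkovKernel.map _ (by fun_prop)

theorem lintegral_referenceKernel (c : Fin m → ℝ) {F : (Fin (m + 1) → ℝ) → ℝ≥0∞}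
    (hF : Measurable F) :
    ∫⁻ y, F y ∂referenceKernel P N c = ∫⁻ w, F (relayOffset c + w) ∂gaussianOutputLaw P N := by
  rw [referenceKernel, Kernel.lintegral_map _ (by fun_prop) _ hF,
    Kernel.lintegral_id_prod (by fun_prop)]
  simp

theorem compProd_referenceKernel (p : Measure (Fin (m + 1) → ℝ)) [IsProbabilityMeasure p] :
    (p.map relayInputs).compProd (referenceKernel P N) =
      (p.prod (gaussianOutputLaw P N)).map fun w =>
        (relayInputs w.1, relayOffset (relayInputs w.1) + w.2) := by
  refine Measure.ext_of_lintegral _ fun F hF => ?_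
  rw [Measure.lintegral_compProd hF, lintegral_map hF (by fun_prop),
    lintegral_prod _ (by fun_prop : Measurable _).aemeasurable,
    lintegral_map hF.lintegral_kernel_prod_right' (by fun_prop)]
  exact lintegral_congr fun x => lintegral_referenceKernel _ (by fun_prop)

theorem map_relayInputs_fst (p : Measure (Fin (m + 1) → ℝ)) [IsProbabilityMeasure p] :
    (p.prod (noiseLaw N)).map (fun ω => relayInputs ω.1) = p.map relayInputs := by
  rw [← Function.comp_def relayInputs Prod.fst, ← Measure.map_map (by fun_prop) (by fun_prop),
    Measure.map_fst_prod]
  simp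

/-- The conditional law of the source reassembles with the relay law into the true joint input law.
The reference output uses the relay inputs only as an offset to an independent draw. -/
theorem compProd_condDistrib_prod_referenceKernel (p : Measure (Fin (m + 1) → ℝ))
    [IsProbabilityMeasure p] :
    ((p.prod (noiseLaw N)).map fun ω => relayInputs ω.1).compProd
      ((condDistrib (fun ω => sourceInput ω.1) (fun ω => relayInputs ω.1)
        (p.prod (noiseLaw N))).prod (referenceKernel P N)) =
      (p.prod (gaussianOutputLaw P N)).map fun w =>
        (relayInputs w.1, sourceInput w.1, relayOffset (relayInputs w.1) + w.2) := by
  refine Measure.ext_of_lintegral _ fun F hF => ?_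
  set G : (Fin m → ℝ) × ℝ → ℝ≥0∞ := fun v =>
    ∫⁻ w, F (v.1, v.2, relayOffset v.1 + w) ∂gaussianOutputLaw P N with hG
  have hGm : Measurable G :=
    Measurable.lintegral_prod_right' (f := fun q : ((Fin m → ℝ) × ℝ) × (Fin (m + 1) → ℝ) =>
      F (q.1.1, q.1.2, relayOffset q.1.1 + q.2)) (by fun_prop)
  have h1 : ∀ c, ∫⁻ w, F (c, w) ∂((condDistrib (fun ω => sourceInput ω.1)
      (fun ω => relayInputs ω.1) (p.prod (noiseLaw N))).prod (referenceKernel P N)) c =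
      ∫⁻ a, G (c, a) ∂condDistrib (fun ω => sourceInput ω.1)
        (fun ω => relayInputs ω.1) (p.prod (noiseLaw N)) c := by
    intro c
    rw [Kernel.lintegral_prod _ _ _ (by fun_prop)]
    exact lintegral_congr fun a => lintegral_referenceKernel _ (by fun_prop)
  rw [Measure.lintegral_compProd hF]
  simp_rw [h1]
  rw [← Measure.lintegral_compProd hGm, compProd_map_condDistrib (by fun_prop),
    lintegral_map hGm (by fun_prop), lintegral_prod _ (by fun_prop : Measurable _).aemeasurable,
    lintegral_map hF (by fun_prop), lintegral_prod _ (by fun_prop : Measurable _).aemeasurable]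
  simp [hG]

/-- The cut information falls short of its Gaussian value by the divergence of the law of the relay
inputs and received signals from the reference law, and by the unused source power. -/
theorem klDiv_add_cutInfo (hN : ∀ j, 0 < N j) (p : ProbabilityMeasure (Fin (m + 1) → ℝ))
    (hp : Integrable (fun x => sourceInput x ^ 2) (p : Measure (Fin (m + 1) → ℝ))) :
    klDiv (((p : Measure (Fin (m + 1) → ℝ)).prod (noiseLaw N)).map
        fun ω => (relayInputs ω.1, received ω.1 ω.2))
      (((p : Measure (Fin (m + 1) → ℝ)).map relayInputs).compProd (referenceKernel P N)) +
      cutInfo N p =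
      ENNReal.ofReal (1 / 2 * Real.log (1 + P * totalPrecision N) +
        (∫ x, sourceInput x ^ 2 ∂(p : Measure (Fin (m + 1) → ℝ)) - P) *
          (totalPrecision N / (2 * (1 + P * totalPrecision N)))) := by
  let μ := (p : Measure (Fin (m + 1) → ℝ))
  have hf : Measurable fun w : (Fin (m + 1) → ℝ) × (Fin (m + 1) → ℝ) =>
      (relayInputs w.1, sourceInput w.1, relayOffset (relayInputs w.1) + w.2) := by fun_prop
  have hcons : Measurable fun w : (Fin m → ℝ) × ℝ × (Fin (m + 1) → ℝ) =>
      (Fin.cons w.2.1 w.1 : Fin (m + 1) → ℝ) := by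
    refine measurable_pi_lambda _ (Fin.cases ?_ fun k => ?_)
    · simpa using by fun_prop
    · simpa using by fun_prop
  have hg : Measurable fun w : (Fin m → ℝ) × ℝ × (Fin (m + 1) → ℝ) =>
      ((Fin.cons w.2.1 w.1 : Fin (m + 1) → ℝ), w.2.2 - relayOffset w.1) := by fun_prop
  -- Relay and source inputs together recover the whole input vector, and subtracting the offset
  -- recovers the rest, so passing to these coordinates preserves divergence.
  have hgf : Function.LeftInverse (fun w : (Fin m → ℝ) × ℝ × (Fin (m + 1) → ℝ) =>
      ((Fin.cons w.2.1 w.1 : Fin (m + 1) → ℝ), w.2.2 - relayOffset w.1))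
      fun w : (Fin (m + 1) → ℝ) × (Fin (m + 1) → ℝ) =>
        (relayInputs w.1, sourceInput w.1, relayOffset (relayInputs w.1) + w.2) := by
    intro w
    refine Prod.ext (funext (Fin.cases ?_ fun k => ?_)) ?_ <;> simp [sourceInput, relayInputs]
  have hs : Measurable fun w : (Fin (m + 1) → ℝ) × (Fin (m + 1) → ℝ) =>
      (w.1, fun j => sourceInput w.1 + w.2 j) := by fun_prop
  have hmap : (μ.prod (noiseLaw N)).map
      (fun ω => (relayInputs ω.1, sourceInput ω.1, received ω.1 ω.2)) =
      ((μ.prod (noiseLaw N)).map fun w => (w.1, fun j => sourceInput w.1 + w.2 j)).map fun w =>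
        (relayInputs w.1, sourceInput w.1, relayOffset (relayInputs w.1) + w.2) := by
    rw [Measure.map_map hf hs]
    simp_rw [received_eq]
    rfl
  rw [cutInfo, ← map_relayInputs_fst (N := N) μ,
    klDiv_add_condMutualInfo _ (by fun_prop) measurable_received (by fun_prop),
    compProd_condDistrib_prod_referenceKernel, hmap, klDiv_map_of_leftInverse _ _ hf hg hgf,
    klDiv_signal_add_noise μ measurable_sourceInput hp hN]

/-! ### Upper bound and attainment -/

theorem cutInfo_le (hN : ∀ j, 0 < N j) (p : ProbabilityMeasure (Fin (m + 1) → ℝ))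
    (hp : Integrable (fun x => sourceInput x ^ 2) (p : Measure (Fin (m + 1) → ℝ)))
    (hP : ∫ x, sourceInput x ^ 2 ∂(p : Measure (Fin (m + 1) → ℝ)) ≤ P) :
    cutInfo N p ≤ ENNReal.ofReal (1 / 2 * Real.log (1 + P * totalPrecision N)) := by
  refine (le_add_self.trans_eq (klDiv_add_cutInfo (P := P) hN p hp)).trans
    (ENNReal.ofReal_le_ofReal ?_)
  have := totalPrecision_nonneg N
  have := mul_nonneg (sub_nonneg.2 hP)
    (by positivity : 0 ≤ totalPrecision N / (2 * (1 + P * totalPrecision N)))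
  linarith

/-- By independence, conditioning on the relay inputs leaves the source $\mathcal N(0,P)$, so the
conditional output law is exactly the reference kernel. -/
theorem map_relayInputs_received (p : Measure (Fin (m + 1) → ℝ)) [IsProbabilityMeasure p]
    (hlaw : HasLaw sourceInput (gaussianReal 0 P) p) (hind : IndepFun sourceInput relayInputs p) :
    (p.prod (noiseLaw N)).map (fun ω => (relayInputs ω.1, received ω.1 ω.2)) =
      (p.map relayInputs).compProd (referenceKernel P N) := by
  have hprod : p.map (fun x => (sourceInput x, relayInputs x)) =
      (gaussianReal 0 P).prod (p.map relayInputs) := by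
    rw [hind.map_prod_eq_prod_map_map (by fun_prop) (by fun_prop), hlaw.map_eq]
  refine Measure.ext_of_lintegral _ fun F hF => ?_
  have hH : Measurable fun q : ℝ × (Fin m → ℝ) =>
      ∫⁻ z, F (q.2, relayOffset q.2 + fun j => q.1 + z j) ∂noiseLaw N :=
    Measurable.lintegral_prod_right' (f := fun r : (ℝ × (Fin m → ℝ)) × (Fin (m + 1) → ℝ) =>
      F (r.1.2, relayOffset r.1.2 + fun j => r.1.1 + r.2 j)) (by fun_prop)
  have : IsProbabilityMeasure (p.map relayInputs) :=
    Measure.isProbabilityMeasure_map (by fun_prop)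
  simp_rw [received_eq]
  rw [lintegral_map hF (by fun_prop), lintegral_prod _ (by fun_prop : Measurable _).aemeasurable,
    ← lintegral_map (g := fun x => (sourceInput x, relayInputs x)) hH (by fun_prop), hprod,
    lintegral_prod_symm _ hH.aemeasurable, Measure.lintegral_compProd hF]
  refine lintegral_congr fun c => ?_
  rw [lintegral_referenceKernel c (by fun_prop), gaussianOutputLaw,
    lintegral_map (by fun_prop) (by fun_prop),
    lintegral_prod _ (by fun_prop : Measurable _).aemeasurable]

/-- Both deficits in `klDiv_add_cutInfo` vanish: the output law is the reference law, and the source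
power is fully used. -/
theorem cutInfo_eq (hN : ∀ j, 0 < N j) (p : ProbabilityMeasure (Fin (m + 1) → ℝ))
    (hlaw : HasLaw sourceInput (gaussianReal 0 P) (p : Measure (Fin (m + 1) → ℝ)))
    (hind : IndepFun sourceInput relayInputs (p : Measure (Fin (m + 1) → ℝ))) :
    cutInfo N p = ENNReal.ofReal (1 / 2 * Real.log (1 + P * totalPrecision N)) := by
  have hsq : Integrable (fun a : ℝ => a ^ 2) (gaussianReal 0 P) :=
    (memLp_id_gaussianReal (μ := 0) (v := P) 2).integrable_sq
  have hvar : ∫ a, a ^ 2 ∂gaussianReal 0 P = P := by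
    rw [← variance_of_integral_eq_zero (X := fun a => a) (by fun_prop) (by simp),
      variance_fun_id_gaussianReal]
  have hp : Integrable (fun x => sourceInput x ^ 2) (p : Measure (Fin (m + 1) → ℝ)) := by
    rw [← hlaw.map_eq] at hsq
    exact hsq.comp_measurable measurable_sourceInput
  have hint : ∫ x, sourceInput x ^ 2 ∂(p : Measure (Fin (m + 1) → ℝ)) = P := by
    rw [← hvar, ← hlaw.map_eq, integral_map (by fun_prop) (by fun_prop)]
  have h := klDiv_add_cutInfo (P := P) hN p hp
  rwa [map_relayInputs_received _ hlaw hind, klDiv_self, zero_add, hint, sub_self, zero_mul,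
    add_zero] at h

theorem indepFun_sourceInput_relayInputs (p : Measure (Fin (m + 1) → ℝ))
    (h : iIndepFun (fun (i : Fin (m + 1)) (x : Fin (m + 1) → ℝ) => x i) p) :
    IndepFun sourceInput relayInputs p := by
  have h' := h.indepFun_finset {0} {i | i ≠ 0} (by simp) fun i => measurable_pi_apply i
  have hφ : Measurable fun v : ({0} : Finset (Fin (m + 1))) → ℝ => v ⟨0, by simp⟩ :=
    measurable_pi_apply _
  have hψ : Measurable fun (v : ({i | i ≠ 0} : Finset (Fin (m + 1))) → ℝ) (k : Fin m) =>
      v ⟨k.succ, by simp [Fin.succ_ne_zero]⟩ := measurable_pi_lambda _ fun k => measurable_pi_apply _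
  exact h'.comp hφ hψ

theorem indepGaussianInputs_mem_admissible (P : Fin (m + 1) → ℝ≥0) :
    indepGaussianInputs P ∈ admissible P := by
  intro i
  have hmp := measurePreserving_eval (fun j => gaussianReal 0 (P j)) i
  have hsq : Integrable (fun a : ℝ => a ^ 2) (gaussianReal 0 (P i)) :=
    (memLp_id_gaussianReal (μ := 0) (v := P i) 2).integrable_sq
  refine ⟨hmp.integrable_comp_of_integrable hsq, le_of_eq ?_⟩
  change ∫ x : Fin (m + 1) → ℝ, x i ^ 2 ∂Measure.pi (fun j => gaussianReal 0 (P j)) = _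
  rw [integral_comp_eval (μ := fun j => gaussianReal 0 (P j)) (f := fun a => a ^ 2) (by fun_prop),
    ← variance_of_integral_eq_zero (X := fun a => a) (by fun_prop) (by simp),
    variance_fun_id_gaussianReal]

theorem cutInfo_indepGaussianInputs (hN : ∀ j, 0 < N j) (P : Fin (m + 1) → ℝ≥0) :
    cutInfo N (indepGaussianInputs P) =
      ENNReal.ofReal (1 / 2 * Real.log (1 + P 0 * totalPrecision N)) :=
  cutInfo_eq hN _
    (measurePreserving_eval (fun j => gaussianReal 0 (P j)) 0).hasLaw
    (indepFun_sourceInput_relayInputs _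
      (iIndepFun_pi (X := fun _ a => a) fun _ => aemeasurable_id))

end

end RelayChannel

theorem theorem1 (m : ℕ) (P N : Fin (m + 1) → ℝ≥0) (hN : ∀ j, 0 < N j) :
    -- the maximum over all input distributions exists and has the stated value
    IsGreatest (RelayChannel.cutInfo N '' RelayChannel.admissible P)
      (ENNReal.ofReal (1 / 2 * Real.log (1 + P 0 * ∑ j, 1 / (N j : ℝ)))) ∧
    -- Gaussian inputs with the source at full power and independent of the relays achieve it
    (∀ p ∈ RelayChannel.admissible P,
      (∀ i, HasGaussianLaw (fun x : Fin (m + 1) → ℝ => x i) (p : Measure (Fin (m + 1) → ℝ))) →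
      HasLaw RelayChannel.sourceInput (gaussianReal 0 (P 0))
        (p : Measure (Fin (m + 1) → ℝ)) →
      IndepFun RelayChannel.sourceInput RelayChannel.relayInputs
        (p : Measure (Fin (m + 1) → ℝ)) →
      IsMaxOn (RelayChannel.cutInfo N) (RelayChannel.admissible P) p) ∧
    -- fully independent Gaussian inputs with the source at full power achieve it
    (∀ p ∈ RelayChannel.admissible P,
      (∀ i, HasGaussianLaw (fun x : Fin (m + 1) → ℝ => x i) (p : Measure (Fin (m + 1) → ℝ))) →
      HasLaw RelayChannel.sourceInput (gaussianReal 0 (P 0))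
        (p : Measure (Fin (m + 1) → ℝ)) →
      iIndepFun (fun (i : Fin (m + 1)) (x : Fin (m + 1) → ℝ) => x i)
        (p : Measure (Fin (m + 1) → ℝ)) →
      IsMaxOn (RelayChannel.cutInfo N) (RelayChannel.admissible P) p) ∧
    -- in particular independent centred Gaussian inputs of variances `P i` achieve it
    (RelayChannel.indepGaussianInputs P ∈ RelayChannel.admissible P ∧
      IsMaxOn (RelayChannel.cutInfo N) (RelayChannel.admissible P)
        (RelayChannel.indepGaussianInputs P)) := by
  have hle : ∀ p ∈ RelayChannel.admissible P, RelayChannel.cutInfo N p ≤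
      ENNReal.ofReal (1 / 2 * Real.log (1 + P 0 * RelayChannel.totalPrecision N)) :=
    fun p hp => RelayChannel.cutInfo_le hN p (hp 0).1 (hp 0).2
  refine ⟨⟨⟨_, RelayChannel.indepGaussianInputs_mem_admissible P,
    RelayChannel.cutInfo_indepGaussianInputs hN P⟩, ?_⟩, ?_, ?_,
    RelayChannel.indepGaussianInputs_mem_admissible P, ?_⟩
  · rintro _ ⟨p, hp, rfl⟩
    exact hle p hp
  · intro p _ _ hlaw hind q hq
    exact (hle q hq).trans_eq (RelayChannel.cutInfo_eq hN p hlaw hind).symm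
  · intro p _ _ hlaw hind q hq
    exact (hle q hq).trans_eq (RelayChannel.cutInfo_eq hN p hlaw
      (RelayChannel.indepFun_sourceInput_relayInputs _ hind)).symm
  · intro q hq
    exact (hle q hq).trans_eq (RelayChannel.cutInfo_indepGaussianInputs hN P).symm
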